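/- Let $p,\upsilon\ge 1$ and $n,s\ge 0$ be integers and let $H,C\in\mathbb{C}^{p\times p}$ satisfy $HC=CH$, $\operatorname{Re}(z)>-1$ for every eigenvalue $z$ of $C$, and $\operatorname{Re}(x)>1+(1+\upsilon)\max\{n,s\}$ for every eigenvalue $x$ of $H$. Write $u^{S}=\exp(S\ln u)$ for $u>0$, $(S)_0=I$ and $(S)_k=S(S+I)\cdots(S+(k-1)I)$ for $k\ge1$, and, for a matrix $S$ all of whose eigenvalues have positive real part, $\Gamma(S)=\int_0^\infty e^{-u}u^{S-I}\,du$; $\Gamma^{-1}(S)$ is the inverse matrix of $\Gamma(S)$. Define $$M_{n}^{(H,C)}(u;\upsilon)=\sum_{j=0}^{n}(-1)^{j+n}\binom{n}{j}\big((n+1)I-H\big)_{\upsilon j}\,(I+C)_{\upsilon n}\,\big((I+C)_{\upsilon j}\big)^{-1}(-u)^{\upsilon j},$$ $$\mathcal{M}_{s}^{(H,C)}(u;\upsilon)=\sum_{r=0}^{s}\sum_{j=0}^{r}\frac{(-1)^{j+s}}{r!}\binom{r}{j}\Big(\tfrac1\upsilon\big((j+1)I+C\big)\Big)_{s}\,(H+C-sI)_{r}\,u^{r}(1+u)^{s-r}.$$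 Then all matrix inverses occurring above and below exist, the integral $$\Lambda_{ns}=\int_0^\infty u^{C}(1+u)^{-(H+C)}\,M_{n}^{(H,C)}(u;\upsilon)\,\mathcal{M}_{s}^{(H,C)}(u;\upsilon)\,du$$ converges absolutely, and $$\Lambda_{ns}=\begin{cases} s!\,\Gamma^{-1}(H+C-sI)\,\Gamma\big(C+(\upsilon s+1)I\big)\,\Gamma(H-sI)\,\big(H-I-(\upsilon+1)sI\big)^{-1}, & s=n,\\ 0, & s\ne n.\end{cases}$$ -/

import Mathlib

open MeasureTheory Set

noncomputable section

/-- The matrix power `u ^ S = exp (S ln u)` of a positive real number `u`. -/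
def matRpow {p : ℕ} (u : ℝ) (S : Matrix (Fin p) (Fin p) ℂ) : Matrix (Fin p) (Fin p) ℂ :=
  NormedSpace.exp (((Real.log u : ℝ) : ℂ) • S)

/-- The integral over `(0, ∞)` of a matrix-valued function of a real variable, taken entry
by entry. -/
def matIntegral {p : ℕ} (F : ℝ → Matrix (Fin p) (Fin p) ℂ) : Matrix (Fin p) (Fin p) ℂ :=
  Matrix.of fun i j => ∫ u in Ioi (0 : ℝ), F u i j

/-- Absolute convergence of the integral over `(0, ∞)` of a matrix-valued function: every entry
is Lebesgue integrable. -/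
def MatIntegrable {p : ℕ} (F : ℝ → Matrix (Fin p) (Fin p) ℂ) : Prop :=
  ∀ i j, IntegrableOn (fun u => F u i j) (Ioi (0 : ℝ))

/-- The Gamma matrix function `Γ(S) = ∫₀^∞ e^{-u} u^{S - I} du` (for positive stable `S`). -/
def matGamma {p : ℕ} (S : Matrix (Fin p) (Fin p) ℂ) : Matrix (Fin p) (Fin p) ℂ :=
  matIntegral fun u => ((Real.exp (-u) : ℝ) : ℂ) • matRpow u (S - 1)

/-- The matrix Pochhammer symbol `(S)_k = S (S + I) ⋯ (S + (k - 1) I)`, with `(S)_0 = I`. -/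
def matPoch {p : ℕ} (S : Matrix (Fin p) (Fin p) ℂ) : ℕ → Matrix (Fin p) (Fin p) ℂ
  | 0 => 1
  | k + 1 => matPoch S k * (S + (k : ℂ) • 1)

/-- The first polynomial `M_n^{(H,C)}(u; υ)` of the pair. -/
def polyM {p : ℕ} (H C : Matrix (Fin p) (Fin p) ℂ) (υ n : ℕ) (u : ℝ) :
    Matrix (Fin p) (Fin p) ℂ :=
  ∑ j ∈ Finset.range (n + 1),
    ((-1 : ℂ) ^ (j + n) * (n.choose j : ℂ) * (-(u : ℂ)) ^ (υ * j)) •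
      (matPoch (((n : ℂ) + 1) • 1 - H) (υ * j) * matPoch (1 + C) (υ * n) *
        (matPoch (1 + C) (υ * j))⁻¹)

/-- The second polynomial `𝓜_n^{(H,C)}(u; υ)` of the pair. -/
def polyCalM {p : ℕ} (H C : Matrix (Fin p) (Fin p) ℂ) (υ n : ℕ) (u : ℝ) :
    Matrix (Fin p) (Fin p) ℂ :=
  ∑ r ∈ Finset.range (n + 1), ∑ j ∈ Finset.range (r + 1),
    ((-1 : ℂ) ^ (j + n) / (r.factorial : ℂ) * (r.choose j : ℂ) *
        (u : ℂ) ^ r * (1 + (u : ℂ)) ^ (n - r)) •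
      (matPoch ((1 / (υ : ℂ)) • (((j : ℂ) + 1) • 1 + C)) n *
        matPoch (H + C - (n : ℂ) • 1) r)

/-- The matrix weight `u^C (1 + u)^{-(H + C)}`. -/
def matWeight {p : ℕ} (H C : Matrix (Fin p) (Fin p) ℂ) (u : ℝ) : Matrix (Fin p) (Fin p) ℂ :=
  matRpow u C * matRpow (1 + u) (-(H + C))

end

open Filter Topology WeakDual Polynomial

namespace CommBanach

noncomputable section

/-! ### Powers `u ^ S` in a Banach algebra, and their growth. -/

section
variable {A : Type*} [NormedCommRing A] [NormedAlgebra ℂ A]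

/-! Since `H` and `C` commute, every matrix in the statement lies in the finite-dimensional
commutative algebra generated by them. There the characters `φ` play the role of joint eigenvalues:
`φ H` and `φ C` are eigenvalues of `H` and `C`, so the spectral hypotheses bound their real parts.
Gelfand theory turns such bounds into norm estimates for `u ^ S`, hence convergence, and into
invertibility, since an element killed by no character is a unit. Gamma and Beta integrals then obey
the scalar rules (`bgamma_add_one`, `bgamma_mul_integral_beta`).

Each term of the weight times `u ^ (υ j)` times the second polynomial is a Beta integrand. Summing
the Beta values is Newton interpolation of `z ↦ ((z + 1 + C) / υ)_s`, evaluated at `z = -(C + 1 + υ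
j)`, where it equals `(-j)_s`. The moment is therefore `j (j - 1) ⋯ (j - s + 1) Γ(C + 1 + υ j) Γ(H -
s - 1 - υ j)` divided by `Γ(H + C - s)` (`integrableOn_moment_and_eq`).

In the pairing with the first polynomial, `j` runs up to `n`. If `s > n`, every falling factorial
vanishes; if `s = n`, only `j = n` survives. If `s < n`, the Gamma factors reduce to `Γ(H - n)`
times a polynomial in `j`, so that the sum is the `n`-th difference of a polynomial of degree below
`n`. -/

theorem bddAbove_re_character [CompleteSpace A] (S : A) :
    ∃ b : ℝ, ∀ φ : characterSpace ℂ A, (φ S).re < b := by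
  obtain ⟨b, hb⟩ := ((spectrum.isCompact (𝕜 := ℂ) S).image Complex.continuous_re).bddAbove
  refine ⟨b + 1, fun φ => lt_of_le_of_lt (hb ⟨φ S, ?_, rfl⟩) (lt_add_one b)⟩
  exact CharacterSpace.mem_spectrum_iff_exists.2 ⟨φ, rfl⟩

/-- The spectrum is compact and nonempty, so the least real part is attained. The gap leaves room
for a strict exponent in the norm bounds. -/
theorem exists_gap_re_character [CompleteSpace A] [Nontrivial A] {S : A} {a : ℝ}
    (h : ∀ φ : characterSpace ℂ A, a < (φ S).re) :
    ∃ a' > a, ∀ φ : characterSpace ℂ A, a' < (φ S).re := by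
  obtain ⟨z, hz, hmin⟩ := (spectrum.isCompact (𝕜 := ℂ) S).exists_isMinOn (spectrum.nonempty S)
    Complex.continuous_re.continuousOn
  obtain ⟨φ, rfl⟩ := CharacterSpace.mem_spectrum_iff_exists.1 hz
  obtain ⟨a', h1, h2⟩ := exists_between (h φ)
  exact ⟨a', h1, fun ψ => h2.trans_le
    (hmin (CharacterSpace.mem_spectrum_iff_exists.2 ⟨ψ, rfl⟩))⟩

theorem isUnit_of_character_ne_zero [CompleteSpace A] {S : A}
    (h : ∀ φ : characterSpace ℂ A, φ S ≠ 0) : IsUnit S := by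
  by_contra hS
  obtain ⟨φ, hφ⟩ := CharacterSpace.exists_apply_eq_zero hS
  exact h φ hφ

theorem character_exp [CompleteSpace A] (φ : characterSpace ℂ A) (S : A) :
    φ (NormedSpace.exp S) = Complex.exp (φ S) := by
  let _ : NormedAlgebra ℚ A := NormedAlgebra.restrictScalars ℚ ℂ A
  rw [Complex.exp_eq_exp_ℂ]
  exact NormedSpace.map_exp φ (map_continuous φ) S

/-- Gelfand's formula: the spectral radius of `exp S` is below `e ^ b`, so the bound holds with
constant 1 for large `n`; the finitely many other powers are absorbed in `K`. -/
theorem exists_norm_exp_pow_le [CompleteSpace A] [Nontrivial A] {S : A} {b : ℝ}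
    (h : ∀ φ : characterSpace ℂ A, (φ S).re < b) :
    ∃ K : ℝ, 0 < K ∧ ∀ n : ℕ, ‖NormedSpace.exp S ^ n‖ ≤ K * Real.exp (b * n) := by
  set E := NormedSpace.exp S
  have h1 : spectralRadius ℂ E < (Real.toNNReal (Real.exp b) : ENNReal) := by
    refine spectrum.spectralRadius_lt_of_forall_lt E fun z hz => ?_
    obtain ⟨φ, rfl⟩ := CharacterSpace.mem_spectrum_iff_exists.1 hz
    rw [← NNReal.coe_lt_coe, Real.coe_toNNReal _ (Real.exp_pos b).le, coe_nnnorm, character_exp, Complex.norm_exp]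
    exact Real.exp_lt_exp.2 (h φ)
  have h2 := (spectrum.pow_nnnorm_pow_one_div_tendsto_nhds_spectralRadius E).eventually_lt_const h1
  obtain ⟨N, hN⟩ := eventually_atTop.1 (h2.and (eventually_gt_atTop 0))
  refine ⟨1 + ∑ m ∈ Finset.range N, ‖E ^ m‖ * Real.exp (-(b * m)), by positivity, fun n => ?_⟩
  have hpos : 0 ≤ ∑ m ∈ Finset.range N, ‖E ^ m‖ * Real.exp (-(b * m)) := by positivity
  by_cases hn : N ≤ n
  · obtain ⟨h3, h4⟩ := hN n hn
    have h5 : ‖E ^ n‖ ≤ Real.exp (b * n) := by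
      have h6 := (ENNReal.rpow_lt_rpow_iff (z := (n : ℝ)) (by positivity)).2 h3
      rw [← ENNReal.rpow_mul, one_div, inv_mul_cancel₀ (by positivity), ENNReal.rpow_one,
        ENNReal.rpow_natCast, ← ENNReal.coe_pow, ENNReal.coe_lt_coe] at h6
      have h7 := NNReal.coe_lt_coe.2 h6
      rw [coe_nnnorm, NNReal.coe_pow, Real.coe_toNNReal _ (Real.exp_pos b).le] at h7
      rw [mul_comm, Real.exp_nat_mul]
      exact h7.le
    nlinarith [Real.exp_pos (b * n)]
  · have h3 : ‖E ^ n‖ * Real.exp (-(b * n)) ≤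
        ∑ m ∈ Finset.range N, ‖E ^ m‖ * Real.exp (-(b * m)) :=
      Finset.single_le_sum (f := fun m : ℕ => ‖E ^ m‖ * Real.exp (-(b * m)))
        (fun _ _ => by positivity) (Finset.mem_range.2 (not_le.1 hn))
    calc ‖E ^ n‖ = ‖E ^ n‖ * Real.exp (-(b * n)) * Real.exp (b * n) := by
          rw [mul_assoc, ← Real.exp_add, neg_add_cancel, Real.exp_zero, mul_one]
      _ ≤ _ := by gcongr; linarith

theorem exists_norm_exp_smul_le [CompleteSpace A] [Nontrivial A] {S : A} {b : ℝ}
    (h : ∀ φ : characterSpace ℂ A, (φ S).re < b) :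
    ∃ K : ℝ, 0 < K ∧ ∀ t : ℝ, 0 ≤ t →
      ‖NormedSpace.exp ((t : ℂ) • S)‖ ≤ K * Real.exp (b * t) := by
  let _ : NormedAlgebra ℚ A := NormedAlgebra.restrictScalars ℚ ℂ A
  obtain ⟨K, hK, hKn⟩ := exists_norm_exp_pow_le h
  have hc : Continuous fun t : ℝ => NormedSpace.exp ((t : ℂ) • S) :=
    NormedSpace.exp_continuous.comp (by fun_prop)
  obtain ⟨L, hL⟩ := (isCompact_Icc (a := (0 : ℝ)) (b := 1)).exists_bound_of_continuousOn
    hc.continuousOn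
  have hL0 : 0 ≤ L := (norm_nonneg _).trans (hL 0 (by simp))
  -- Split `t` into integer and fractional parts: `K` bounds the integer power, `L` the fractional
  -- factor, and `e ^ |b|` pays for replacing `⌊t⌋` by `t` whatever the sign of `b`.
  refine ⟨K * (L + 1) * Real.exp |b|, by positivity, fun t ht => ?_⟩
  have hfl := Nat.floor_le ht
  have hfl' := Nat.lt_floor_add_one t
  set n := ⌊t⌋₊
  have h1 : NormedSpace.exp ((t : ℂ) • S) =
      NormedSpace.exp S ^ n * NormedSpace.exp (((t - n : ℝ) : ℂ) • S) := by
    rw [← NormedSpace.exp_nsmul, ← NormedSpace.exp_add, ← Nat.cast_smul_eq_nsmul ℂ, ← add_smul]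
    congr 2
    push_cast
    ring
  rw [h1]
  have h2 := hL (t - n) ⟨by linarith, by linarith⟩
  have h3 : Real.exp (b * n) ≤ Real.exp |b| * Real.exp (b * t) := by
    rw [← Real.exp_add]
    refine Real.exp_le_exp.2 ?_
    have : -b * (t - n) ≤ |b| * 1 :=
      mul_le_mul (neg_le_abs b) (by linarith) (by linarith) (abs_nonneg b)
    linarith
  calc _ ≤ ‖NormedSpace.exp S ^ n‖ * ‖NormedSpace.exp (((t - n : ℝ) : ℂ) • S)‖ := norm_mul_le _ _
    _ ≤ (K * (Real.exp |b| * Real.exp (b * t))) * (L + 1) := by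
        refine mul_le_mul ((hKn n).trans ?_) (by linarith) (norm_nonneg _) (by positivity)
        gcongr
    _ = _ := by ring

/-- The power `u ^ S = exp (S ln u)` in a complex Banach algebra. -/
def bpow (u : ℝ) (S : A) : A := NormedSpace.exp (((Real.log u : ℝ) : ℂ) • S)

theorem bpow_add [CompleteSpace A] (u : ℝ) (S T : A) : bpow u (S + T) = bpow u S * bpow u T := by
  let _ : NormedAlgebra ℚ A := NormedAlgebra.restrictScalars ℚ ℂ A
  rw [bpow, smul_add, NormedSpace.exp_add, bpow, bpow]

theorem mul_bpow [CompleteSpace A] {u v : ℝ} (hu : 0 < u) (hv : 0 < v) (S : A) :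
    bpow (u * v) S = bpow u S * bpow v S := by
  let _ : NormedAlgebra ℚ A := NormedAlgebra.restrictScalars ℚ ℂ A
  rw [bpow, bpow, bpow, ← NormedSpace.exp_add, Real.log_mul hu.ne' hv.ne', ← add_smul]
  push_cast
  rfl

theorem bpow_zero (u : ℝ) : bpow u (0 : A) = 1 := by
  rw [bpow, smul_zero, NormedSpace.exp_zero]

theorem bpow_neg_mul [CompleteSpace A] (u : ℝ) (S : A) : bpow u (-S) * bpow u S = 1 := by
  rw [← bpow_add, neg_add_cancel, bpow_zero]

theorem bpow_one [CompleteSpace A] {u : ℝ} (hu : 0 < u) : bpow u (1 : A) = (u : ℂ) • 1 := by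
  let _ : NormedAlgebra ℚ A := NormedAlgebra.restrictScalars ℚ ℂ A
  have h := NormedSpace.map_exp (algebraMap ℂ A) (algebraMapCLM ℂ A).continuous (Real.log u : ℂ)
  rw [bpow, ← Algebra.algebraMap_eq_smul_one, ← h, ← Complex.exp_eq_exp_ℂ, ← Complex.ofReal_exp,
    Real.exp_log hu, Algebra.algebraMap_eq_smul_one]

theorem bpow_natCast [CompleteSpace A] {u : ℝ} (hu : 0 < u) (k : ℕ) :
    bpow u (k : A) = (u : ℂ) ^ k • 1 := by
  induction k with
  | zero => simp [bpow_zero]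
  | succ k ih => rw [Nat.cast_succ, bpow_add, ih, bpow_one hu, smul_mul_smul_comm, mul_one, pow_succ]

theorem character_bpow [CompleteSpace A] (φ : characterSpace ℂ A) {u : ℝ} (hu : 0 < u) (S : A) :
    φ (bpow u S) = (u : ℂ) ^ (φ S) := by
  rw [bpow, character_exp, map_smul, Complex.cpow_def_of_ne_zero (by exact_mod_cast hu.ne'),
    Complex.ofReal_log hu.le, smul_eq_mul]

theorem continuousOn_bpow [CompleteSpace A] (S : A) :
    ContinuousOn (fun u : ℝ => bpow u S) (Ioi 0) := by
  let _ : NormedAlgebra ℚ A := NormedAlgebra.restrictScalars ℚ ℂ A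
  refine NormedSpace.exp_continuous.comp_continuousOn ?_
  have : ContinuousOn Real.log (Ioi 0) :=
    Real.continuousOn_log.mono fun x (hx : 0 < x) => hx.ne'
  fun_prop

theorem hasDerivAt_bpow [CompleteSpace A] {u : ℝ} (hu : 0 < u) (S : A) :
    HasDerivAt (fun u : ℝ => bpow u S) (S * bpow u (S - 1)) u := by
  have h1 := (hasDerivAt_exp_smul_const S (Real.log u : ℂ)).scomp u
    ((Real.hasDerivAt_log hu.ne').ofReal_comp)
  refine h1.congr_deriv ?_
  have h2 : bpow u S = bpow u (S - 1) * ((u : ℂ) • 1) := by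
    rw [← bpow_one hu, ← bpow_add, sub_add_cancel]
  change _ • (bpow u S * S) = _
  rw [h2]
  have : (u : ℂ) ≠ 0 := by exact_mod_cast hu.ne'
  rw [mul_smul_comm, mul_one, smul_mul_assoc, smul_smul, Complex.ofReal_inv, inv_mul_cancel₀ this,
    one_smul, mul_comm]

/-- The exponential bound for `S` covers `u ≥ 1`, and the one for `-S` covers `u ≤ 1`; the sum of
two powers serves both ranges. -/
theorem exists_norm_bpow_le [CompleteSpace A] [Nontrivial A] {S : A} {a b : ℝ}
    (ha : ∀ φ : characterSpace ℂ A, a < (φ S).re)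
    (hb : ∀ φ : characterSpace ℂ A, (φ S).re < b) :
    ∃ K : ℝ, 0 < K ∧ ∀ u : ℝ, 0 < u → ‖bpow u S‖ ≤ K * (u ^ a + u ^ b) := by
  obtain ⟨K, hK, hK'⟩ := exists_norm_exp_smul_le hb
  obtain ⟨L, hL, hL'⟩ := exists_norm_exp_smul_le (S := -S) (b := -a) (by simpa using ha)
  refine ⟨K + L, by positivity, fun u hu => ?_⟩
  have p1 : 0 < u ^ a := Real.rpow_pos_of_pos hu a
  have p2 : 0 < u ^ b := Real.rpow_pos_of_pos hu b
  rcases le_total 0 (Real.log u) with h | h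
  · have := hK' _ h
    rw [mul_comm b, ← Real.rpow_def_of_pos hu] at this
    rw [bpow]
    nlinarith
  · have := hL' (-Real.log u) (by linarith)
    rw [neg_mul_neg, mul_comm a, ← Real.rpow_def_of_pos hu] at this
    rw [Complex.ofReal_neg, neg_smul_neg] at this
    rw [bpow]
    nlinarith

end

/-! ### The Gamma function in a Banach algebra. -/

section
variable {A : Type*} [NormedCommRing A] [NormedAlgebra ℂ A]

/-- The Gamma function `∫₀^∞ e^{-u} u^{S - 1} du` of a complex Banach algebra. -/
def bgamma (S : A) : A := ∫ u in Ioi (0 : ℝ), ((Real.exp (-u) : ℝ) : ℂ) • bpow u (S - 1)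


theorem continuousOn_bgamma_integrand [CompleteSpace A] (S : A) :
    ContinuousOn (fun u : ℝ => ((Real.exp (-u) : ℝ) : ℂ) • bpow u S) (Ioi 0) :=
  ContinuousOn.smul (by fun_prop) (continuousOn_bpow S)

theorem norm_bgamma_integrand (u : ℝ) (S : A) :
    ‖((Real.exp (-u) : ℝ) : ℂ) • bpow u S‖ = Real.exp (-u) * ‖bpow u S‖ := by
  rw [norm_smul, Complex.norm_real, Real.norm_of_nonneg (Real.exp_pos _).le]

theorem bgamma_scaling_aux [CompleteSpace A] (S : A) {c u : ℝ} (hc : 0 < c) (hu : 0 < u) :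
    ((Real.exp (-(c * u)) : ℝ) : ℂ) • bpow u (S - 1) =
      bpow c (-(S - 1)) * (((Real.exp (-(c * u)) : ℝ) : ℂ) • bpow (c * u) (S - 1)) := by
  rw [mul_bpow hc hu, mul_smul_comm, ← mul_assoc, bpow_neg_mul, one_mul]

variable [CompleteSpace A] [Nontrivial A]

theorem exists_re_bounds {S : A} (h : ∀ φ : characterSpace ℂ A, 0 < (φ S).re) :
    ∃ a b : ℝ, 0 < a ∧ 0 < b ∧ (∀ φ : characterSpace ℂ A, a < (φ S).re) ∧
      ∀ φ : characterSpace ℂ A, (φ S).re < b := by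
  obtain ⟨a, ha, ha'⟩ := exists_gap_re_character h
  obtain ⟨b, hb⟩ := bddAbove_re_character S
  obtain ⟨φ⟩ : Nonempty (characterSpace ℂ A) := inferInstance
  exact ⟨a, b, ha, (h φ).trans (hb φ), ha', hb⟩

theorem exists_norm_bpow_sub_one_le {S : A} {a b : ℝ}
    (ha : ∀ φ : characterSpace ℂ A, a < (φ S).re)
    (hb : ∀ φ : characterSpace ℂ A, (φ S).re < b) :
    ∃ K : ℝ, 0 < K ∧ ∀ u : ℝ, 0 < u →
      ‖bpow u (S - 1)‖ ≤ K * (u ^ (a - 1) + u ^ (b - 1)) :=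
  exists_norm_bpow_le (by simpa using ha) (by simpa using hb)

theorem integrableOn_bgamma {S : A} (h : ∀ φ : characterSpace ℂ A, 0 < (φ S).re) :
    IntegrableOn (fun u : ℝ => ((Real.exp (-u) : ℝ) : ℂ) • bpow u (S - 1)) (Ioi 0) := by
  obtain ⟨a, b, ha, hb, ha', hb'⟩ := exists_re_bounds h
  obtain ⟨K, hK, hle⟩ := exists_norm_bpow_sub_one_le ha' hb'
  refine Integrable.mono' (((Real.GammaIntegral_convergent ha).add
    (Real.GammaIntegral_convergent hb)).const_mul K)
    ((continuousOn_bgamma_integrand _).aestronglyMeasurable measurableSet_Ioi) ?_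
  refine (ae_restrict_iff' measurableSet_Ioi).2 (ae_of_all _ fun u hu => ?_)
  rw [norm_bgamma_integrand]
  calc _ ≤ Real.exp (-u) * (K * (u ^ (a - 1) + u ^ (b - 1))) := by gcongr; exact hle u hu
    _ = _ := by simp only [Pi.add_apply]; ring

theorem character_bgamma {S : A} (h : ∀ φ : characterSpace ℂ A, 0 < (φ S).re)
    (φ : characterSpace ℂ A) : φ (bgamma S) = Complex.Gamma (φ S) := by
  rw [Complex.Gamma_eq_integral (h φ), Complex.GammaIntegral, bgamma]
  have h1 := (CharacterSpace.toCLM φ).integral_comp_comm (integrableOn_bgamma h)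
  refine h1.symm.trans (setIntegral_congr_fun measurableSet_Ioi fun u hu => ?_)
  change φ _ = _
  rw [map_smul, character_bpow φ hu, map_sub, map_one, smul_eq_mul]

theorem isUnit_bgamma {S : A} (h : ∀ φ : characterSpace ℂ A, 0 < (φ S).re) :
    IsUnit (bgamma S) := by
  refine isUnit_of_character_ne_zero fun φ => ?_
  rw [character_bgamma h]
  exact Complex.Gamma_ne_zero_of_re_pos (h φ)

theorem tendsto_rpow_mul_exp_neg_nhdsGT {a : ℝ} (ha : 0 < a) :
    Tendsto (fun u : ℝ => Real.exp (-u) * u ^ a) (𝓝[>] 0) (𝓝 0) := by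
  have : ContinuousAt (fun u : ℝ => Real.exp (-u) * u ^ a) 0 :=
    ContinuousAt.mul (by fun_prop) (Real.continuousAt_rpow_const _ _ (Or.inr ha.le))
  have h := this.tendsto
  rw [Real.zero_rpow ha.ne', mul_zero] at h
  exact h.mono_left nhdsWithin_le_nhds

theorem tendsto_rpow_mul_exp_neg_atTop (a : ℝ) :
    Tendsto (fun u : ℝ => Real.exp (-u) * u ^ a) atTop (𝓝 0) := by
  have := tendsto_rpow_mul_exp_neg_mul_atTop_nhds_zero a 1 one_pos
  simpa [mul_comm] using this

theorem tendsto_bgamma_integrand {S : A} (h : ∀ φ : characterSpace ℂ A, 0 < (φ S).re) :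
    Tendsto (fun u : ℝ => ((Real.exp (-u) : ℝ) : ℂ) • bpow u S) (𝓝[>] 0) (𝓝 0) ∧
    Tendsto (fun u : ℝ => ((Real.exp (-u) : ℝ) : ℂ) • bpow u S) atTop (𝓝 0) := by
  obtain ⟨a, b, ha, hb, ha', hb'⟩ := exists_re_bounds h
  obtain ⟨K, hK, hle⟩ := exists_norm_bpow_le ha' hb'
  have key : ∀ u : ℝ, 0 < u → ‖((Real.exp (-u) : ℝ) : ℂ) • bpow u S‖ ≤
      K * (Real.exp (-u) * u ^ a + Real.exp (-u) * u ^ b) := fun u hu => by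
    rw [norm_bgamma_integrand]
    calc _ ≤ Real.exp (-u) * (K * (u ^ a + u ^ b)) := by gcongr; exact hle u hu
      _ = _ := by ring
  constructor
  · refine squeeze_zero_norm' (eventually_nhdsWithin_of_forall key) ?_
    simpa using ((tendsto_rpow_mul_exp_neg_nhdsGT ha).add
      (tendsto_rpow_mul_exp_neg_nhdsGT hb)).const_mul K
  · refine squeeze_zero_norm' ((eventually_gt_atTop 0).mono key) ?_
    simpa using ((tendsto_rpow_mul_exp_neg_atTop a).add
      (tendsto_rpow_mul_exp_neg_atTop b)).const_mul K

/-- Integrate the derivative of `e ^ (-u) u ^ S`, which vanishes at both ends; the integration by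
parts formula is used with second factor 1. -/
theorem bgamma_add_one {S : A} (h : ∀ φ : characterSpace ℂ A, 0 < (φ S).re) :
    bgamma (S + 1) = S * bgamma S := by
  have h1 : ∀ φ : characterSpace ℂ A, 0 < (φ (S + 1)).re := fun φ => by
    have := h φ
    simp only [map_add, map_one, Complex.add_re, Complex.one_re]
    linarith
  have i1 := integrableOn_bgamma h1
  rw [add_sub_cancel_right] at i1
  have i2 := (integrableOn_bgamma h).const_mul S
  obtain ⟨t0, t1⟩ := tendsto_bgamma_integrand h
  have hd : ∀ u ∈ Ioi (0 : ℝ), HasDerivAt (fun u : ℝ => ((Real.exp (-u) : ℝ) : ℂ) • bpow u S)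
      (S * (((Real.exp (-u) : ℝ) : ℂ) • bpow u (S - 1)) - ((Real.exp (-u) : ℝ) : ℂ) • bpow u S)
      u := fun u hu => by
    have e1 : HasDerivAt (fun u : ℝ => ((Real.exp (-u) : ℝ) : ℂ)) (-((Real.exp (-u) : ℝ) : ℂ)) u := by
      have := ((hasDerivAt_neg u).exp).ofReal_comp
      simpa using this
    refine (e1.smul (hasDerivAt_bpow hu S)).congr_deriv ?_
    rw [mul_smul_comm, neg_smul, ← sub_eq_add_neg]
  have hfilter : ∀ l : Filter ℝ, Tendsto (fun u : ℝ => ((Real.exp (-u) : ℝ) : ℂ) • bpow u S) l (𝓝 0) →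
      Tendsto ((fun u : ℝ => ((Real.exp (-u) : ℝ) : ℂ) • bpow u S) * fun _ => (1 : A)) l (𝓝 0) :=
    fun l hl => by
      refine hl.congr fun u => ?_
      rw [Pi.mul_apply, mul_one]
  have h2 := integral_Ioi_deriv_mul_eq_sub (v := fun _ => (1 : A)) (v' := fun _ => 0) hd
    (fun u _ => hasDerivAt_const u 1)
    (by
      refine (i2.sub i1).congr (ae_of_all _ fun u => ?_)
      simp only [Pi.add_apply, Pi.mul_apply, Pi.sub_apply, mul_one, mul_zero, add_zero])
    (hfilter _ t0) (hfilter _ t1)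
  simp only [mul_one, mul_zero, add_zero] at h2
  rw [integral_sub i2 i1, integral_const_mul_of_integrable (integrableOn_bgamma h), sub_self,
    sub_eq_zero] at h2
  rw [bgamma, add_sub_cancel_right, ← h2, bgamma]

theorem integrableOn_exp_neg_mul_bpow {S : A} (h : ∀ φ : characterSpace ℂ A, 0 < (φ S).re)
    {c : ℝ} (hc : 0 < c) :
    IntegrableOn (fun u : ℝ => ((Real.exp (-(c * u)) : ℝ) : ℂ) • bpow u (S - 1)) (Ioi 0) := by
  have h1 := integrableOn_bgamma h
  rw [← mul_zero c, ← integrableOn_Ioi_comp_mul_left_iff _ _ hc] at h1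
  exact (integrableOn_congr_fun (fun u hu => bgamma_scaling_aux S hc hu) measurableSet_Ioi).2
    (h1.const_mul (bpow c (-(S - 1))))

theorem integral_exp_neg_mul_bpow {S : A} (h : ∀ φ : characterSpace ℂ A, 0 < (φ S).re)
    {c : ℝ} (hc : 0 < c) :
    ∫ u in Ioi (0 : ℝ), ((Real.exp (-(c * u)) : ℝ) : ℂ) • bpow u (S - 1) =
      bpow c (-S) * bgamma S := by
  have h1 := integrableOn_bgamma h
  rw [← mul_zero c, ← integrableOn_Ioi_comp_mul_left_iff _ _ hc] at h1
  rw [setIntegral_congr_fun measurableSet_Ioi (fun u hu => bgamma_scaling_aux S hc hu),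
    integral_const_mul_of_integrable h1, 
    integral_comp_mul_left_Ioi (fun u : ℝ => ((Real.exp (-u) : ℝ) : ℂ) • bpow u (S - 1)) _ hc,
    mul_zero, ← bgamma]
  have h2 : bpow c (-(S - 1)) = bpow c (-S) * ((c : ℂ) • 1) := by
    rw [← bpow_one hc, ← bpow_add]
    congr 1
    ring
  rw [h2, ← Complex.coe_smul, mul_smul_comm, mul_smul_comm, mul_one, smul_mul_assoc, smul_smul,
    Complex.ofReal_inv, inv_mul_cancel₀ (by exact_mod_cast hc.ne'), one_smul]

end

/-! ### The Beta integral, by Fubini. -/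

section
-- Scalar majorant for Fubini: integrating in `u` first, by the substitution `t u`, leaves `Γ(a) e ^
-- (-t) t ^ (c - 1)`.
theorem integrable_exp_neg_mul_rpow_prod {a c : ℝ} (ha : 0 < a) (hc : 0 < c) :
    Integrable (fun z : ℝ × ℝ => Real.exp (-((1 + z.1) * z.2)) * ((z.1 * z.2) ^ (a - 1) * z.2 ^ c))
      ((volume.restrict (Ioi 0)).prod (volume.restrict (Ioi 0))) := by
  have hmeas : Measurable fun z : ℝ × ℝ =>
      Real.exp (-((1 + z.1) * z.2)) * ((z.1 * z.2) ^ (a - 1) * z.2 ^ c) := by fun_prop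
  have hG := Real.GammaIntegral_convergent ha
  have heq : ∀ t : ℝ, 0 < t → ∀ u : ℝ, 0 < u →
      Real.exp (-((1 + u) * t)) * ((u * t) ^ (a - 1) * t ^ c) =
        (Real.exp (-t) * t ^ c) * (Real.exp (-(t * u)) * (t * u) ^ (a - 1)) := fun t _ u _ => by
    rw [show -((1 + u) * t) = -t + -(t * u) by ring, Real.exp_add, mul_comm u t]
    ring
  refine (integrable_prod_iff' hmeas.aestronglyMeasurable).2 ⟨?_, ?_⟩
  · refine (ae_restrict_iff' measurableSet_Ioi).2 (ae_of_all _ fun t ht => ?_)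
    have h1 := hG
    rw [← mul_zero t, ← integrableOn_Ioi_comp_mul_left_iff _ _ ht] at h1
    exact (integrableOn_congr_fun (fun u hu => heq t ht u hu) measurableSet_Ioi).2
      (h1.const_mul _)
  · have h2 : EqOn (fun t : ℝ => ∫ u in Ioi (0 : ℝ),
        ‖Real.exp (-((1 + u) * t)) * ((u * t) ^ (a - 1) * t ^ c)‖)
        (fun t => Real.Gamma a * (Real.exp (-t) * t ^ (c - 1))) (Ioi 0) := fun t ht => by
      have ht' : (0 : ℝ) < t := ht
      have h3 : EqOn (fun u : ℝ => ‖Real.exp (-((1 + u) * t)) * ((u * t) ^ (a - 1) * t ^ c)‖)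
          (fun u => (Real.exp (-t) * t ^ c) * (Real.exp (-(t * u)) * (t * u) ^ (a - 1)))
          (Ioi 0) := fun u hu => by
        have hu' : (0 : ℝ) < u := hu
        simp only
        rw [Real.norm_of_nonneg (by positivity), heq t ht u hu]
      simp only
      rw [setIntegral_congr_fun measurableSet_Ioi h3, integral_const_mul,
        integral_comp_mul_left_Ioi (fun u => Real.exp (-u) * u ^ (a - 1)) _ ht', mul_zero,
        ← Real.Gamma_eq_integral ha, Real.rpow_sub_one ht'.ne', smul_eq_mul]
      ring
    exact (integrableOn_congr_fun h2 measurableSet_Ioi).2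
      ((Real.GammaIntegral_convergent hc).const_mul _)

variable {A : Type*} [NormedCommRing A] [NormedAlgebra ℂ A] [CompleteSpace A] [Nontrivial A]

/-- The integrand of the double integral that evaluates the Beta integral. -/
def betaKernel (X Y : A) (u t : ℝ) : A :=
  ((Real.exp (-((1 + u) * t)) : ℝ) : ℂ) • (bpow u (X - 1) * bpow t (X + Y - 1))

theorem integrable_betaKernel {X Y : A} (hX : ∀ φ : characterSpace ℂ A, 0 < (φ X).re)
    (hY : ∀ φ : characterSpace ℂ A, 0 < (φ Y).re) :
    Integrable (Function.uncurry (betaKernel X Y))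
      ((volume.restrict (Ioi 0)).prod (volume.restrict (Ioi 0))) := by
  obtain ⟨a, b, ha, hb, ha', hb'⟩ := exists_re_bounds hX
  obtain ⟨c, d, hc, hd, hc', hd'⟩ := exists_re_bounds hY
  obtain ⟨K, hK, hle⟩ := exists_norm_bpow_sub_one_le ha' hb'
  obtain ⟨L, hL, hle'⟩ := exists_norm_bpow_le hc' hd'
  have hI := (((integrable_exp_neg_mul_rpow_prod ha hc).add
    (integrable_exp_neg_mul_rpow_prod ha hd)).add
    ((integrable_exp_neg_mul_rpow_prod hb hc).add
    (integrable_exp_neg_mul_rpow_prod hb hd))).const_mul (K * L)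
  rw [Measure.prod_restrict] at hI ⊢
  refine hI.mono' (ContinuousOn.aestronglyMeasurable ?_ (measurableSet_Ioi.prod measurableSet_Ioi))
    ((ae_restrict_iff' (measurableSet_Ioi.prod measurableSet_Ioi)).2 (ae_of_all _ ?_))
  · refine ContinuousOn.smul (by fun_prop) (ContinuousOn.mul ?_ ?_)
    · exact (continuousOn_bpow _).comp continuousOn_fst fun z hz => hz.1
    · exact (continuousOn_bpow _).comp continuousOn_snd fun z hz => hz.2
  · rintro ⟨u, t⟩ ⟨hu, ht⟩
    have hu' : (0 : ℝ) < u := hu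
    have ht' : (0 : ℝ) < t := ht
    -- Regrouped so that the two norm bounds produce exactly the scalar majorants.
    have h1 : bpow u (X - 1) * bpow t (X + Y - 1) = bpow (u * t) (X - 1) * bpow t Y := by
      rw [mul_bpow hu' ht', mul_assoc, ← bpow_add]
      congr 2
      ring
    simp only [Function.uncurry, betaKernel, Pi.add_apply]
    rw [h1, norm_smul, Complex.norm_real, Real.norm_of_nonneg (Real.exp_pos _).le]
    calc _ ≤ Real.exp (-((1 + u) * t)) * ((K * ((u * t) ^ (a - 1) + (u * t) ^ (b - 1))) *
          (L * (t ^ c + t ^ d))) := by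
          gcongr
          exact (norm_mul_le _ _).trans (mul_le_mul (hle _ (by positivity)) (hle' _ ht')
            (norm_nonneg _) (by positivity))
      _ = _ := by ring

theorem integral_betaKernel_right {X Y : A} (hX : ∀ φ : characterSpace ℂ A, 0 < (φ X).re)
    (hY : ∀ φ : characterSpace ℂ A, 0 < (φ Y).re) {u : ℝ} (hu : 0 < u) :
    ∫ t in Ioi (0 : ℝ), betaKernel X Y u t =
      bgamma (X + Y) * (bpow u (X - 1) * bpow (1 + u) (-(X + Y))) := by
  have hXY : ∀ φ : characterSpace ℂ A, 0 < (φ (X + Y)).re := fun φ => by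
    rw [map_add, Complex.add_re]
    exact add_pos (hX φ) (hY φ)
  have hu1 : 0 < 1 + u := by linarith
  simp only [betaKernel, ← mul_smul_comm]
  rw [integral_const_mul_of_integrable (integrableOn_exp_neg_mul_bpow hXY hu1),
    integral_exp_neg_mul_bpow hXY hu1]
  ring

theorem integral_betaKernel_left {X Y : A} (hX : ∀ φ : characterSpace ℂ A, 0 < (φ X).re)
    {t : ℝ} (ht : 0 < t) :
    ∫ u in Ioi (0 : ℝ), betaKernel X Y u t =
      bgamma X * (((Real.exp (-t) : ℝ) : ℂ) • bpow t (Y - 1)) := by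
  have h1 : ∀ u : ℝ, betaKernel X Y u t =
      (((Real.exp (-t) : ℝ) : ℂ) • bpow t (X + Y - 1)) *
        (((Real.exp (-(t * u)) : ℝ) : ℂ) • bpow u (X - 1)) := fun u => by
    rw [betaKernel, smul_mul_smul_comm, ← Complex.ofReal_mul, ← Real.exp_add, mul_comm (bpow t _)]
    congr 3
    ring_nf
  simp only [h1]
  rw [integral_const_mul_of_integrable (integrableOn_exp_neg_mul_bpow hX ht),
    integral_exp_neg_mul_bpow hX ht, smul_mul_assoc, ← mul_assoc, ← bpow_add, mul_smul_comm,
    mul_comm]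
  congr 3
  ring

/-- Fubini already makes the inner `t`-integral integrable in `u`; it is `Γ(X + Y)` times this
integrand, and `Γ(X + Y)` is a unit. -/
theorem integrableOn_beta {X Y : A} (hX : ∀ φ : characterSpace ℂ A, 0 < (φ X).re)
    (hY : ∀ φ : characterSpace ℂ A, 0 < (φ Y).re) :
    IntegrableOn (fun u : ℝ => bpow u (X - 1) * bpow (1 + u) (-(X + Y))) (Ioi 0) := by
  have hXY : ∀ φ : characterSpace ℂ A, 0 < (φ (X + Y)).re := fun φ => by
    rw [map_add, Complex.add_re]
    exact add_pos (hX φ) (hY φ)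
  obtain ⟨g, hg⟩ := isUnit_bgamma hXY
  have h1 := ((integrable_betaKernel hX hY).integral_prod_left).const_mul (↑g⁻¹ : A)
  refine (integrableOn_congr_fun (fun u hu => ?_) measurableSet_Ioi).1 h1
  simp only [Function.uncurry]
  rw [integral_betaKernel_right hX hY hu, ← hg, Units.inv_mul_cancel_left]

/-- The Beta integral in a commutative complex Banach algebra. -/
theorem bgamma_mul_integral_beta {X Y : A} (hX : ∀ φ : characterSpace ℂ A, 0 < (φ X).re)
    (hY : ∀ φ : characterSpace ℂ A, 0 < (φ Y).re) :
    bgamma (X + Y) * ∫ u in Ioi (0 : ℝ), bpow u (X - 1) * bpow (1 + u) (-(X + Y)) =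
      bgamma X * bgamma Y := by
  rw [← integral_const_mul_of_integrable (integrableOn_beta hX hY),
    ← setIntegral_congr_fun measurableSet_Ioi (fun u hu => integral_betaKernel_right hX hY hu),
    integral_integral_swap (integrable_betaKernel hX hY),
    setIntegral_congr_fun measurableSet_Ioi (fun t ht => integral_betaKernel_left hX ht),
    integral_const_mul_of_integrable (integrableOn_bgamma hY), ← bgamma]

end

/-! ### Finite differences and Newton interpolation. -/

section
theorem ascPochhammer_eval_neg_natCast {R : Type*} [CommRing R] (m r : ℕ) :
    (ascPochhammer R r).eval (-(m : R)) = (-1) ^ r * (m.descFactorial r : R) := by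
  rw [ascPochhammer_eval_neg_eq_descPochhammer, descPochhammer_eval_eq_descFactorial]

/-- Newton's forward difference formula for the power `m ^ k`, truncated at any order `s ≥ k`. -/
theorem natCast_pow_eq_sum_choose {k s : ℕ} (hks : k ≤ s) (m : ℕ) :
    (m : ℂ) ^ k = ∑ r ∈ Finset.range (s + 1), (m.choose r : ℂ) *
      ∑ i ∈ Finset.range (r + 1), (-1) ^ (r - i) * (r.choose i : ℂ) * (i : ℂ) ^ k := by
  have h1 := shift_eq_sum_fwdDiff_iter (1 : ℂ) (fun x => x ^ k) m 0
  simp only [nsmul_eq_mul, mul_one, zero_add] at h1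
  have h2 : ∀ r : ℕ, (fwdDiff (1 : ℂ))^[r] (fun x => x ^ k) 0 =
      ∑ i ∈ Finset.range (r + 1), (-1) ^ (r - i) * (r.choose i : ℂ) * (i : ℂ) ^ k := fun r => by
    rw [fwdDiff_iter_eq_sum_shift]
    refine Finset.sum_congr rfl fun i _ => ?_
    simp [zsmul_eq_mul]
  simp only [← h2]
  rw [h1]
  rcases le_total m s with h | h
  · refine Finset.sum_subset (Finset.range_mono (by lia)) fun r _ hr => ?_
    rw [Nat.choose_eq_zero_of_lt (by simpa using hr), Nat.cast_zero, zero_mul]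
  · refine (Finset.sum_subset (Finset.range_mono (by lia)) fun r _ hr => ?_).symm
    rw [Finset.mem_range, not_lt] at hr
    rw [fwdDiff_iter_pow_eq_zero_of_lt (by lia : k < r), Pi.zero_apply, mul_zero]

/-- At `X = -m` one has `(-m)_r = (-1) ^ r r! (m choose r)`, and the identity is Newton's formula
for `m ^ k`; agreement at infinitely many points suffices. -/
theorem sum_ascPochhammer_eq_neg_X_pow {k s : ℕ} (hks : k ≤ s) :
    ∑ r ∈ Finset.range (s + 1), C ((r.factorial : ℂ)⁻¹ *
      ∑ i ∈ Finset.range (r + 1), (-1) ^ i * (r.choose i : ℂ) * (i : ℂ) ^ k) * ascPochhammer ℂ r =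
      (-X : ℂ[X]) ^ k := by
  refine eq_of_infinite_eval_eq _ _ (Set.Infinite.mono ?_
    (Set.infinite_range_of_injective (f := fun m : ℕ => -(m : ℂ))
      fun a b hab => by simpa using hab))
  rintro _ ⟨m, rfl⟩
  simp only [mem_ofPred_eq, eval_finsetSum, eval_mul, eval_C, eval_pow, eval_neg, eval_X, neg_neg]
  rw [natCast_pow_eq_sum_choose hks m]
  refine Finset.sum_congr rfl fun r _ => ?_
  have hr : (r.factorial : ℂ) ≠ 0 := by exact_mod_cast r.factorial_ne_zero
  rw [ascPochhammer_eval_neg_natCast, Nat.descFactorial_eq_factorial_mul_choose, Nat.cast_mul,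
    Finset.mul_sum, Finset.mul_sum, Finset.sum_mul]
  refine Finset.sum_congr rfl fun i hi => ?_
  have h3 : ((-1 : ℂ) ^ (r - i)) = (-1) ^ i * (-1) ^ r := by
    obtain ⟨d, rfl⟩ := Nat.exists_eq_add_of_le (Nat.lt_succ_iff.1 (Finset.mem_range.1 hi))
    rw [Nat.add_sub_cancel_left, pow_add, ← mul_assoc, ← mul_pow]
    simp
  rw [h3]
  field_simp

/-- Newton interpolation of a polynomial of degree at most `s` at the nodes `0, …, s`, written
with rising factorials. -/
theorem sum_ascPochhammer_mul_sum_eval {R : Type*} [CommRing R] [Algebra ℂ R] {s : ℕ} (P : R[X])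
    (hP : P.natDegree ≤ s) (x : R) :
    ∑ r ∈ Finset.range (s + 1), (r.factorial : ℂ)⁻¹ • ((ascPochhammer R r).eval x *
      ∑ i ∈ Finset.range (r + 1), ((-1) ^ i * (r.choose i : ℂ)) • P.eval (i : R)) =
      P.eval (-x) := by
  -- Both sides are linear in `P`, so monomials suffice; for these the identity over `ℂ[X]` is
  -- evaluated at `x`.
  have hk : ∀ k ≤ s, ∑ r ∈ Finset.range (s + 1), (r.factorial : ℂ)⁻¹ •
      ((ascPochhammer R r).eval x *
      ∑ i ∈ Finset.range (r + 1), ((-1) ^ i * (r.choose i : ℂ)) • (i : R) ^ k) = (-x) ^ k := by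
    intro k hks
    have h1 := congrArg (aeval x) (sum_ascPochhammer_eq_neg_X_pow hks)
    simp only [map_sum, map_mul, map_pow, map_neg, aeval_X, aeval_C] at h1
    rw [← h1]
    refine Finset.sum_congr rfl fun r _ => ?_
    have h2 : aeval x (ascPochhammer ℂ r) = (ascPochhammer R r).eval x := by
      rw [aeval_def, eval₂_eq_eval_map, ascPochhammer_map]
    rw [h2, Algebra.smul_def, Finset.mul_sum, Finset.mul_sum, Finset.mul_sum, Finset.sum_mul]
    refine Finset.sum_congr rfl fun i _ => ?_
    rw [Algebra.smul_def]
    simp only [map_mul, map_pow, map_natCast, map_neg, map_one]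
    ring
  have he : ∀ y : R, P.eval y = ∑ k ∈ Finset.range (s + 1), P.coeff k * y ^ k := fun y =>
    eval_eq_sum_range' (Nat.lt_succ_of_le hP) y
  rw [he (-x), Finset.sum_congr rfl fun k hk' => congrArg (P.coeff k * ·)
    (hk k (Nat.lt_succ_iff.1 (Finset.mem_range.1 hk'))).symm]
  simp only [he, Finset.mul_sum, Algebra.smul_def]
  rw [Finset.sum_comm]
  refine Finset.sum_congr rfl fun r _ => ?_
  rw [Finset.sum_comm]
  exact Finset.sum_congr rfl fun i _ => Finset.sum_congr rfl fun k _ => by ring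

theorem sum_choose_mul_eval_eq_zero {R : Type*} [CommRing R] {n : ℕ} (P : R[X])
    (hP : P.natDegree < n) :
    ∑ j ∈ Finset.range (n + 1), (-1) ^ (j + n) * (n.choose j : R) * P.eval (j : R) = 0 := by
  have h1 := congrFun (fwdDiff_iter_eq_zero_of_degree_lt hP) 0
  rw [fwdDiff_iter_eq_sum_shift, Pi.zero_apply] at h1
  rw [← h1]
  refine Finset.sum_congr rfl fun j hj => ?_
  have h3 : ((-1 : R) ^ (j + n)) = (-1) ^ (n - j) := by
    obtain ⟨d, rfl⟩ := Nat.exists_eq_add_of_le (Nat.lt_succ_iff.1 (Finset.mem_range.1 hj))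
    rw [Nat.add_sub_cancel_left, ← add_assoc, pow_add, ← two_mul, pow_mul]
    simp
  simp [zsmul_eq_mul, h3]

theorem neg_one_pow_mul_ascPochhammer_eval {R : Type*} [CommRing R] (k : ℕ) (x : R) :
    (-1) ^ k * (ascPochhammer R k).eval (1 - x) = (ascPochhammer R k).eval (x - k) := by
  rw [← neg_sub x 1, ascPochhammer_eval_neg_eq_descPochhammer, ← mul_assoc, ← mul_pow,
    descPochhammer_eval_eq_ascPochhammer, show x - 1 - (k : R) + 1 = x - k by ring]
  simp

end

/-! ### Moments of the second polynomial. -/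

section
variable {A : Type*} [NormedCommRing A] [NormedAlgebra ℂ A]

/-- The polynomial `M_n^{(h,c)}(u; υ)` for elements `h`, `c` of a commutative algebra. -/
def bpolyM (h c : A) (υ n : ℕ) (u : ℝ) : A :=
  ∑ j ∈ Finset.range (n + 1),
    ((-1 : ℂ) ^ (j + n) * (n.choose j : ℂ) * (-(u : ℂ)) ^ (υ * j)) •
      ((ascPochhammer A (υ * j)).eval (n + 1 - h) * (ascPochhammer A (υ * n)).eval (1 + c) *
        Ring.inverse ((ascPochhammer A (υ * j)).eval (1 + c)))

/-- The polynomial `𝓜_s^{(h,c)}(u; υ)` for elements `h`, `c` of a commutative algebra. -/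
def bpolyCalM (h c : A) (υ s : ℕ) (u : ℝ) : A :=
  ∑ r ∈ Finset.range (s + 1), ∑ i ∈ Finset.range (r + 1),
    ((-1 : ℂ) ^ (i + s) / (r.factorial : ℂ) * (r.choose i : ℂ) *
        (u : ℂ) ^ r * (1 + (u : ℂ)) ^ (s - r)) •
      ((ascPochhammer A s).eval ((1 / (υ : ℂ)) • (i + 1 + c)) *
        (ascPochhammer A r).eval (h + c - s))

/-- The coefficient of `u ^ r (1 + u) ^ (s - r)` in `bpolyCalM`. -/
def bcalCoeff (h c : A) (υ s r : ℕ) : A :=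
  ∑ i ∈ Finset.range (r + 1),
    ((-1 : ℂ) ^ (i + s) / (r.factorial : ℂ) * (r.choose i : ℂ)) •
      ((ascPochhammer A s).eval ((1 / (υ : ℂ)) • (i + 1 + c)) *
        (ascPochhammer A r).eval (h + c - s))

theorem bpolyCalM_eq (h c : A) (υ s : ℕ) (u : ℝ) :
    bpolyCalM h c υ s u = ∑ r ∈ Finset.range (s + 1),
      ((u : ℂ) ^ r * (1 + (u : ℂ)) ^ (s - r)) • bcalCoeff h c υ s r := by
  refine Finset.sum_congr rfl fun r _ => ?_
  rw [bcalCoeff, Finset.smul_sum]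
  refine Finset.sum_congr rfl fun i _ => ?_
  rw [smul_smul]
  congr 1
  ring

/-- The weight `u ^ c (1 + u) ^ {-(h + c)}`. -/
def bweight (h c : A) (u : ℝ) : A := bpow u c * bpow (1 + u) (-(h + c))

theorem natDegree_ascPochhammer_comp_le {R : Type*} [CommRing R] (s : ℕ) {q : R[X]}
    (hq : q.natDegree ≤ 1) : ((ascPochhammer R s).comp q).natDegree ≤ s := by
  nontriviality R
  refine natDegree_comp_le.trans ?_
  calc _ ≤ s * 1 := Nat.mul_le_mul
        (by
          rw [← ascPochhammer_map (algebraMap ℤ R)]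
          exact natDegree_map_le.trans (ascPochhammer_natDegree (S := ℤ) s).le) hq
    _ = s := mul_one s

/-- The finite sum that computes the moment of `bpolyCalM` of order `υ j`. -/
theorem sum_bcalCoeff_mul {h c : A} {υ : ℕ} (hυ : 1 ≤ υ) (s j : ℕ) {y : ℕ → A}
    (hy : ∀ r, (ascPochhammer A r).eval (h + c - s) * y r =
      (ascPochhammer A r).eval (c + 1 + (υ * j : ℕ)) * y 0) :
    ∑ r ∈ Finset.range (s + 1), bcalCoeff h c υ s r * y r = (j.descFactorial s : A) * y 0 := by
  have hυ0 : (υ : ℂ) ≠ 0 := by exact_mod_cast (by lia : υ ≠ 0)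
  -- `(q)_s` has degree at most `s`, takes at the node `i` the value occurring in `bcalCoeff`, and
  -- `q` sends `-(c + 1 + υ j)` to `-j`.
  set q : A[X] := C (algebraMap ℂ A (1 / υ)) * (X + C (1 + c)) with hq
  have hqd : q.natDegree ≤ 1 := by
    refine (natDegree_C_mul_le _ _).trans ((natDegree_add_le _ _).trans ?_)
    simp [natDegree_X_le]
  have hev : ∀ z : A, ((ascPochhammer A s).comp q).eval z =
      (ascPochhammer A s).eval ((1 / (υ : ℂ)) • (z + 1 + c)) := fun z => by
    rw [eval_comp, hq, Algebra.smul_def]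
    simp only [eval_mul, eval_C, eval_add, eval_X]
    ring_nf
  have key := sum_ascPochhammer_mul_sum_eval ((ascPochhammer A s).comp q)
    (natDegree_ascPochhammer_comp_le s hqd) (c + 1 + (υ * j : ℕ))
  simp only [hev] at key
  have h1 : (1 / (υ : ℂ)) • (-(c + 1 + ((υ * j : ℕ) : A)) + 1 + c) = -(j : A) := by
    have : (-(c + 1 + ((υ * j : ℕ) : A)) + 1 + c) = (υ : ℂ) • (-(j : A)) := by
      rw [Nat.cast_smul_eq_nsmul, nsmul_eq_mul]
      push_cast
      ring
    rw [this, smul_smul, one_div_mul_cancel hυ0, one_smul]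
  rw [h1, ascPochhammer_eval_neg_natCast] at key
  have h2 : ∀ r ∈ Finset.range (s + 1), bcalCoeff h c υ s r * y r = (-1) ^ s * ((r.factorial : ℂ)⁻¹ •
      ((ascPochhammer A r).eval (c + 1 + (υ * j : ℕ)) *
      ∑ i ∈ Finset.range (r + 1), ((-1) ^ i * (r.choose i : ℂ)) •
        (ascPochhammer A s).eval ((1 / (υ : ℂ)) • ((i : A) + 1 + c)))) * y 0 := fun r _ => by
    rw [bcalCoeff, Finset.mul_sum, Finset.smul_sum, Finset.mul_sum, Finset.sum_mul, Finset.sum_mul]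
    refine Finset.sum_congr rfl fun i _ => ?_
    rw [smul_mul_assoc, mul_assoc, hy r]
    simp only [Algebra.smul_def, map_mul, map_pow, map_neg, map_one, pow_add, div_eq_mul_inv]
    ring
  rw [Finset.sum_congr rfl h2, ← Finset.sum_mul, ← Finset.mul_sum, key, ← mul_assoc, ← mul_pow]
  simp

variable [CompleteSpace A]

/-- Each term is a Beta integrand with first parameter `c + 1 + m + r`; the second, `h - s - 1 - m`,
does not depend on `r`. -/
theorem bweight_mul_bpolyCalM (h c : A) (υ s m : ℕ) {u : ℝ} (hu : 0 < u) :
    bweight h c u * ((u : ℂ) ^ m • bpolyCalM h c υ s u) = ∑ r ∈ Finset.range (s + 1),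
      bcalCoeff h c υ s r * (bpow u (c + 1 + m + r - 1) *
        bpow (1 + u) (-(c + 1 + m + r + (h - s - 1 - m)))) := by
  rw [bpolyCalM_eq, Finset.smul_sum, Finset.mul_sum]
  refine Finset.sum_congr rfl fun r hr => ?_
  obtain ⟨d, rfl⟩ := Nat.exists_eq_add_of_le (Nat.lt_succ_iff.1 (Finset.mem_range.1 hr))
  rw [Nat.add_sub_cancel_left]
  have hu1 : 0 < 1 + u := by linarith
  have e1 : bpow u (c + 1 + m + r - 1) = bpow u c * ((u : ℂ) ^ m • 1) * ((u : ℂ) ^ r • 1) := by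
    rw [← bpow_natCast hu, ← bpow_natCast hu, ← bpow_add, ← bpow_add]
    congr 1
    ring
  have e2 : bpow (1 + u) (-(c + 1 + m + r + (h - (r + d : ℕ) - 1 - m))) =
      bpow (1 + u) (-(h + c)) * ((1 + (u : ℂ)) ^ d • 1) := by
    rw [show (1 + (u : ℂ)) = ((1 + u : ℝ) : ℂ) by push_cast; rfl, ← bpow_natCast hu1, ← bpow_add]
    congr 1
    push_cast
    ring
  rw [e1, e2, bweight]
  simp only [Algebra.smul_def, map_mul]
  ring

variable [Nontrivial A]

theorem bgamma_add_natCast {S : A} (hS : ∀ φ : characterSpace ℂ A, 0 < (φ S).re) (k : ℕ) :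
    bgamma (S + k) = (ascPochhammer A k).eval S * bgamma S := by
  induction k with
  | zero => simp
  | succ k ih =>
    have : ∀ φ : characterSpace ℂ A, 0 < (φ (S + k)).re := fun φ => by
      rw [map_add, map_natCast, Complex.add_re, Complex.natCast_re]
      have := hS φ
      positivity
    rw [Nat.cast_succ, ← add_assoc, bgamma_add_one this, ih, ascPochhammer_succ_eval]
    ring

theorem integrableOn_moment_and_eq {h c : A} {υ : ℕ} (hυ : 1 ≤ υ) (s j : ℕ)
    (hc : ∀ φ : characterSpace ℂ A, 0 < (φ (c + 1 + (υ * j : ℕ))).re)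
    (hh : ∀ φ : characterSpace ℂ A, 0 < (φ (h - s - 1 - (υ * j : ℕ))).re) :
    IntegrableOn (fun u : ℝ => bweight h c u * ((u : ℂ) ^ (υ * j) • bpolyCalM h c υ s u))
      (Ioi 0) ∧
    bgamma (h + c - s) * ∫ u in Ioi (0 : ℝ),
      bweight h c u * ((u : ℂ) ^ (υ * j) • bpolyCalM h c υ s u) =
      (j.descFactorial s : A) *
        (bgamma (c + 1 + (υ * j : ℕ)) * bgamma (h - s - 1 - (υ * j : ℕ))) := by
  set m := υ * j
  set x : A := c + 1 + (m : A) with hx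
  set y : A := h - s - 1 - (m : A) with hy
  have hxr : ∀ r : ℕ, ∀ φ : characterSpace ℂ A, 0 < (φ (x + r)).re := fun r φ => by
    rw [map_add, map_natCast, Complex.add_re, Complex.natCast_re]
    have := hc φ
    positivity
  have hxy : x + y = h + c - s := by rw [hx, hy]; ring
  have hxy0 : ∀ φ : characterSpace ℂ A, 0 < (φ (h + c - s)).re := fun φ => by
    rw [← hxy, map_add, Complex.add_re]
    exact add_pos (hc φ) (hh φ)
  have hi : ∀ r : ℕ, IntegrableOn
      (fun u : ℝ => bpow u (x + r - 1) * bpow (1 + u) (-(x + r + y))) (Ioi 0) :=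
    fun r => integrableOn_beta (hxr r) hh
  have heq : EqOn (fun u : ℝ => bweight h c u * ((u : ℂ) ^ m • bpolyCalM h c υ s u))
      (fun u => ∑ r ∈ Finset.range (s + 1), bcalCoeff h c υ s r *
        (bpow u (x + r - 1) * bpow (1 + u) (-(x + r + y)))) (Ioi 0) :=
    fun u hu => bweight_mul_bpolyCalM h c υ s m hu
  refine ⟨(integrableOn_congr_fun heq measurableSet_Ioi).2
    (integrable_finsetSum _ fun r _ => (hi r).const_mul _), ?_⟩
  rw [setIntegral_congr_fun measurableSet_Ioi heq,
    integral_finsetSum _ fun r _ => (hi r).const_mul _]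
  simp only [fun r => integral_const_mul_of_integrable (hi r)]
  -- Successive Beta values have ratio `(x)_r / (h + c - s)_r`, written without division; this is
  -- the hypothesis of `sum_bcalCoeff_mul`.
  have hJ : ∀ r : ℕ, (ascPochhammer A r).eval (h + c - s) * (bgamma (h + c - s) *
      ∫ u in Ioi (0 : ℝ), bpow u (x + r - 1) * bpow (1 + u) (-(x + r + y))) =
      (ascPochhammer A r).eval x * (bgamma x * bgamma y) := fun r => by
    have h1 := bgamma_mul_integral_beta (hxr r) hh
    rw [show x + r + y = h + c - s + r by rw [← hxy]; ring, bgamma_add_natCast hxy0,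
      bgamma_add_natCast hc] at h1
    rw [show x + r + y = h + c - s + r by rw [← hxy]; ring, ← mul_assoc, mul_comm (eval _ _), ← mul_assoc]
    rw [mul_comm (eval _ _)] at h1
    exact h1
  have hJ0 := hJ 0
  simp only [ascPochhammer_zero, eval_one, one_mul] at hJ0
  have := sum_bcalCoeff_mul (h := h) (c := c) hυ s j (y := fun r => bgamma (h + c - s) *
      ∫ u in Ioi (0 : ℝ), bpow u (x + r - 1) * bpow (1 + u) (-(x + r + y)))
    (fun r => by rw [hJ0]; exact hJ r)
  simp only [hJ0] at this
  rw [← this, Finset.mul_sum]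
  exact Finset.sum_congr rfl fun r _ => by ring

end

/-! ### The pairing of the two polynomials. -/

section
variable {A : Type*} [NormedCommRing A] [NormedAlgebra ℂ A] [CompleteSpace A]

theorem isUnit_ascPochhammer_eval {S : A} (hS : ∀ φ : characterSpace ℂ A, 0 < (φ S).re) (k : ℕ) :
    IsUnit ((ascPochhammer A k).eval S) := by
  induction k with
  | zero => simp
  | succ k ih =>
    rw [ascPochhammer_succ_eval]
    refine ih.mul (isUnit_of_character_ne_zero fun φ h0 => ?_)
    have h1 := congrArg Complex.re h0
    rw [map_add, map_natCast, Complex.add_re, Complex.natCast_re, Complex.zero_re] at h1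
    have := hS φ
    have := Nat.cast_nonneg (α := ℝ) k
    linarith

/-- The coefficient of `u ^ (υ j)` in `bpolyM`. -/
def bpolyMCoeff (h c : A) (υ n j : ℕ) : A :=
  (-1) ^ (j + n) * (n.choose j : A) * (-1) ^ (υ * j) *
    ((ascPochhammer A (υ * j)).eval (n + 1 - h) * (ascPochhammer A (υ * n)).eval (1 + c) *
        Ring.inverse ((ascPochhammer A (υ * j)).eval (1 + c)))

omit [CompleteSpace A] in
theorem bweight_mul_bpolyM_mul_bpolyCalM (h c : A) (υ n s : ℕ) (u : ℝ) :
    bweight h c u * bpolyM h c υ n u * bpolyCalM h c υ s u = ∑ j ∈ Finset.range (n + 1),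
      bpolyMCoeff h c υ n j *
        (bweight h c u * ((u : ℂ) ^ (υ * j) • bpolyCalM h c υ s u)) := by
  rw [bpolyM, Finset.mul_sum, Finset.sum_mul]
  refine Finset.sum_congr rfl fun j _ => ?_
  rw [bpolyMCoeff, neg_pow (u : ℂ)]
  simp only [Algebra.smul_def, map_mul, map_pow, map_neg, map_one, map_natCast]
  ring

variable [Nontrivial A]

section

variable {h c : A} {υ n s : ℕ} (hυ : 1 ≤ υ) (hc : ∀ φ : characterSpace ℂ A, -1 < (φ c).re)
  (hh : ∀ φ : characterSpace ℂ A, 1 + (1 + (υ : ℝ)) * ((max n s : ℕ) : ℝ) < (φ h).re)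

include hc in
omit [CompleteSpace A] [Nontrivial A] in
theorem re_character_one_add_pos (φ : characterSpace ℂ A) : 0 < (φ (c + 1)).re := by
  have := hc φ
  rw [map_add, map_one, Complex.add_re, Complex.one_re]
  linarith

include hh in
omit [CompleteSpace A] [Nontrivial A] in
-- The lower bound on the spectrum of `h` is exactly what the extreme case `a = j = max n s`
-- requires.
theorem re_character_sub_pos {a j : ℕ} (ha : a ≤ max n s) (hj : j ≤ max n s)
    (φ : characterSpace ℂ A) : 0 < (φ (h - a - 1 - (υ * j : ℕ))).re := by
  have h1 := hh φ
  have h2 : (a : ℝ) ≤ ((max n s : ℕ) : ℝ) := by exact_mod_cast ha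
  have h3 : (υ : ℝ) * j ≤ υ * ((max n s : ℕ) : ℝ) :=
    mul_le_mul_of_nonneg_left (by exact_mod_cast hj) (Nat.cast_nonneg _)
  simp only [map_sub, map_natCast, map_one, Complex.sub_re, Complex.natCast_re, Complex.one_re]
  push_cast at *
  linarith

include hυ hc hh

theorem integrableOn_pairing :
    IntegrableOn (fun u : ℝ => bweight h c u * bpolyM h c υ n u * bpolyCalM h c υ s u)
      (Ioi 0) := by
  simp only [bweight_mul_bpolyM_mul_bpolyCalM]
  refine integrable_finsetSum _ fun j hj => Integrable.const_mul ?_ _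
  refine (integrableOn_moment_and_eq hυ s j (fun φ => ?_) (re_character_sub_pos hh
    (le_max_right _ _) ((Nat.lt_succ_iff.1 (Finset.mem_range.1 hj)).trans (le_max_left _ _)))).1
  rw [map_add, map_natCast, Complex.add_re, Complex.natCast_re]
  have := re_character_one_add_pos hc φ
  positivity

/-- The pairing as a finite sum of Gamma functions. -/
theorem bgamma_mul_integral_pairing :
    bgamma (h + c - s) * ∫ u in Ioi (0 : ℝ),
      bweight h c u * bpolyM h c υ n u * bpolyCalM h c υ s u =
    bgamma (c + 1 + (υ * n : ℕ)) * ∑ j ∈ Finset.range (n + 1), (-1) ^ (j + n) * (n.choose j : A) *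
      ((j.descFactorial s : A) * ((ascPochhammer A (υ * j)).eval (h - n - (υ * j : ℕ)) *
        bgamma (h - s - 1 - (υ * j : ℕ)))) := by
  have hc1 := re_character_one_add_pos hc
  have hmom : ∀ j ∈ Finset.range (n + 1), _ := fun j hj =>
    integrableOn_moment_and_eq (h := h) (c := c) hυ s j (fun φ => by
      rw [map_add, map_natCast, Complex.add_re, Complex.natCast_re]
      have := hc1 φ
      positivity) (re_character_sub_pos hh
    (le_max_right _ _) ((Nat.lt_succ_iff.1 (Finset.mem_range.1 hj)).trans (le_max_left _ _)))
  simp only [bweight_mul_bpolyM_mul_bpolyCalM]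
  rw [integral_finsetSum _ fun j hj => (hmom j hj).1.const_mul _, Finset.mul_sum, Finset.mul_sum]
  refine Finset.sum_congr rfl fun j hj => ?_
  rw [integral_const_mul_of_integrable (hmom j hj).1, mul_left_comm, (hmom j hj).2, bpolyMCoeff,
    bgamma_add_natCast hc1, bgamma_add_natCast hc1, add_comm c 1]
  have hinv := Ring.inverse_mul_cancel _ (isUnit_ascPochhammer_eval hc1 (υ * j))
  rw [add_comm c 1] at hinv
  -- The sign from `(-u) ^ (υ j)` reflects `(n + 1 - h)_{υ j}` into `(h - n - υ j)_{υ j}`, which can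
  -- be merged with Gamma factors.
  have hrefl := neg_one_pow_mul_ascPochhammer_eval (υ * j) (h - n)
  rw [show 1 - (h - n) = n + 1 - h by ring] at hrefl
  rw [← hrefl]
  linear_combination ((-1) ^ (j + n) * (n.choose j : A) * (-1) ^ (υ * j) *
    (ascPochhammer A (υ * j)).eval (n + 1 - h) * (ascPochhammer A (υ * n)).eval (1 + c) *
    (j.descFactorial s : A) * bgamma (1 + c) * bgamma (h - s - 1 - (υ * j : ℕ))) * hinv

omit hυ in
theorem isUnit_bgamma_add_sub : IsUnit (bgamma (h + c - s)) := by
  refine isUnit_bgamma fun φ => ?_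
  have h1 := re_character_sub_pos hh (le_max_right n s) (Nat.zero_le _) φ
  have h2 := re_character_one_add_pos hc φ
  rw [show h + c - s = (c + 1) + (h - s - 1 - (υ * 0 : ℕ)) by simp; ring, map_add, Complex.add_re]
  linarith

theorem integral_pairing_eq_zero (hsn : s ≠ n) :
    ∫ u in Ioi (0 : ℝ), bweight h c u * bpolyM h c υ n u * bpolyCalM h c υ s u = 0 := by
  refine ((isUnit_bgamma_add_sub hc hh).mul_right_eq_zero).1 ?_
  rw [bgamma_mul_integral_pairing hυ hc hh]
  rcases lt_or_gt_of_ne hsn with hlt | hgt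
  · obtain ⟨d, rfl⟩ := Nat.exists_eq_add_of_lt hlt
    set n := s + d + 1 with hn
    -- With `g = h - n - υ j`, the last Gamma factor is `Γ(g + d) = (g)_d Γ(g)`, and `(g)_{υ j} Γ(g)
    -- = Γ(h - n)` is free of `j`. What remains is `P(j)`, of degree at most `s + d = n - 1`.
    set P : A[X] := descPochhammer A s * (ascPochhammer A d).comp (C (-(υ : A)) * X + C (h - n))
      with hP
    have hPd : P.natDegree < n := by
      have h1 : (descPochhammer A s).natDegree ≤ s := by
        rw [← descPochhammer_map (algebraMap ℤ A)]
        exact natDegree_map_le.trans (descPochhammer_natDegree ℤ s).le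
      have h2 := natDegree_ascPochhammer_comp_le (R := A) d
        (q := C (-(υ : A)) * X + C (h - n)) natDegree_linear_le
      have h3 := natDegree_mul_le (p := descPochhammer A s)
        (q := (ascPochhammer A d).comp (C (-(υ : A)) * X + C (h - n)))
      rw [← hP] at h3
      lia
    have hsum := sum_choose_mul_eval_eq_zero P hPd
    refine mul_eq_zero_of_right _ ?_
    rw [← zero_mul (bgamma (h - n)), ← hsum, Finset.sum_mul]
    refine Finset.sum_congr rfl fun j hj => ?_
    have hjn : j ≤ n := Nat.lt_succ_iff.1 (Finset.mem_range.1 hj)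
    have hpos : ∀ φ : characterSpace ℂ A, 0 < (φ (h - n - (υ * j : ℕ))).re := fun φ => by
      have := re_character_sub_pos hh (le_max_left _ _) (hjn.trans (le_max_left _ _)) φ
      rw [show h - n - (υ * j : ℕ) = (h - n - 1 - (υ * j : ℕ)) + 1 by ring, map_add, map_one,
        Complex.add_re, Complex.one_re]
      linarith
    have e1 := bgamma_add_natCast hpos (υ * j)
    rw [sub_add_cancel] at e1
    have e2 := bgamma_add_natCast hpos d
    rw [show h - n - (υ * j : ℕ) + (d : A) = h - s - 1 - (υ * j : ℕ) by
      rw [hn]; push_cast; ring] at e2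
    have e3 : P.eval (j : A) = (j.descFactorial s : A) *
        (ascPochhammer A d).eval (h - n - (υ * j : ℕ)) := by
      rw [hP, eval_mul, eval_comp, descPochhammer_eval_eq_descFactorial]
      congr 2
      simp only [eval_add, eval_mul, eval_C, eval_X]
      push_cast
      ring
    rw [e1, e2, e3]
    ring
  · refine mul_eq_zero_of_right _ (Finset.sum_eq_zero fun j hj => ?_)
    rw [Nat.descFactorial_of_lt (by have := Finset.mem_range.1 hj; lia)]
    simp

omit hυ hc in
omit [Nontrivial A] in
theorem isUnit_sub_sub : IsUnit (h - 1 - (υ + 1) * (s : A)) := by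
  refine isUnit_of_character_ne_zero fun φ h0 => ?_
  have h1 := re_character_sub_pos hh (le_max_right n s) (le_max_right n s) φ
  rw [show h - s - 1 - (υ * s : ℕ) = h - 1 - (υ + 1) * (s : A) by push_cast; ring, h0] at h1
  exact lt_irrefl _ h1

/-- Only `j = s` survives. The factor `h - 1 - (υ + 1) s` is the argument of the last Gamma: it
raises that to `Γ(h - s - υ s)`, which the Pochhammer symbol raises to `Γ(h - s)`. -/
theorem integral_pairing_eq (hsn : s = n) :
    bgamma (h + c - s) * (∫ u in Ioi (0 : ℝ),
      bweight h c u * bpolyM h c υ n u * bpolyCalM h c υ s u) * (h - 1 - (υ + 1) * (s : A)) =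
    (s.factorial : A) * bgamma (c + (υ * s + 1)) * bgamma (h - s) := by
  subst hsn
  have hpos := re_character_sub_pos hh (le_max_right s s) (le_max_right s s)
  have hpos' : ∀ φ : characterSpace ℂ A, 0 < (φ (h - s - (υ * s : ℕ))).re := fun φ => by
    have := hpos φ
    rw [show h - s - (υ * s : ℕ) = (h - s - 1 - (υ * s : ℕ)) + 1 by ring, map_add, map_one,
      Complex.add_re, Complex.one_re]
    linarith
  rw [bgamma_mul_integral_pairing hυ hc hh, Finset.sum_eq_single s]
  · have e1 := bgamma_add_natCast hpos' (υ * s)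
    rw [sub_add_cancel] at e1
    have e2 := bgamma_add_one hpos
    rw [show h - s - 1 - (υ * s : ℕ) + 1 = h - s - (υ * s : ℕ) by ring] at e2
    rw [e1, e2, Nat.choose_self, Nat.descFactorial_self, ← two_mul, pow_mul,
      show c + ((υ : A) * s + 1) = c + 1 + (υ * s : ℕ) by push_cast; ring]
    push_cast
    ring
  · intro j hj hjs
    rw [Nat.descFactorial_of_lt (by have := Finset.mem_range.1 hj; lia)]
    simp
  · intro hs
    simp at hs

end

end

/-! ### Transfer to matrices. -/

section
attribute [local instance] Matrix.linftyOpNormedRing Matrix.linftyOpNormedAlgebra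

/-- A commutative subalgebra of a normed ring is a normed commutative ring. -/
abbrev subalgebraNormedCommRing {R : Type*} [NormedRing R] [Algebra ℂ R] (S : Subalgebra ℂ R)
    (hS : ∀ a ∈ S, ∀ b ∈ S, a * b = b * a) : NormedCommRing S :=
  { (inferInstance : NormedRing S) with
    mul_comm := fun a b => Subtype.ext (hS a a.2 b b.2) }

section Transfer

variable {A : Type*} [NormedCommRing A] [NormedAlgebra ℂ A] {p : ℕ}
  (ι : A →ₐ[ℂ] Matrix (Fin p) (Fin p) ℂ)

theorem map_ascPochhammer_eval (S : A) (k : ℕ) :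
    ι ((ascPochhammer A k).eval S) = matPoch (ι S) k := by
  induction k with
  | zero => simp [matPoch]
  | succ k ih =>
    rw [ascPochhammer_succ_eval, map_mul, ih, map_add, map_natCast, matPoch,
      ← Algebra.algebraMap_eq_smul_one, map_natCast]

theorem map_ringInverse {x : A} (hx : IsUnit x) : ι (Ring.inverse x) = (ι x)⁻¹ := by
  refine (Matrix.inv_eq_left_inv ?_).symm
  rw [← map_mul, Ring.inverse_mul_cancel x hx, map_one]

theorem map_bpolyCalM (h c : A) (υ s : ℕ) (u : ℝ) :
    ι (bpolyCalM h c υ s u) = polyCalM (ι h) (ι c) υ s u := by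
  simp only [bpolyCalM, polyCalM, map_sum, map_smul, map_mul, map_ascPochhammer_eval, map_add,
    map_sub, map_natCast, map_one, add_smul, one_smul, Nat.cast_smul_eq_nsmul, nsmul_one]

theorem map_bpolyM {h c : A} (υ n : ℕ) (hc : ∀ k, IsUnit ((ascPochhammer A k).eval (1 + c)))
    (u : ℝ) : ι (bpolyM h c υ n u) = polyM (ι h) (ι c) υ n u := by
  simp only [bpolyM, polyM, map_sum, map_smul, map_mul, map_ringInverse ι (hc _),
    map_ascPochhammer_eval, map_add, map_sub, map_natCast, map_one, add_smul, one_smul,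
    Nat.cast_smul_eq_nsmul, nsmul_one]

variable [FiniteDimensional ℂ A]

theorem map_bpow (u : ℝ) (S : A) : ι (bpow u S) = matRpow u (ι S) := by
  have : CompleteSpace A := FiniteDimensional.complete ℂ A
  let _ : NormedAlgebra ℚ A := NormedAlgebra.restrictScalars ℚ ℂ A
  rw [bpow, matRpow, ← map_smul]
  exact NormedSpace.map_exp ι (LinearMap.continuous_of_finiteDimensional ι.toLinearMap) _

theorem map_bweight (h c : A) (u : ℝ) : ι (bweight h c u) = matWeight (ι h) (ι c) u := by
  rw [bweight, matWeight, map_mul, map_bpow, map_bpow, map_neg, map_add]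

theorem matIntegrable_map {f : ℝ → A} (hf : IntegrableOn f (Ioi 0)) :
    MatIntegrable fun u => ι (f u) := fun i j =>
  (LinearMap.toContinuousLinearMap
    ((Matrix.entryLinearMap ℂ ℂ i j).comp ι.toLinearMap)).integrable_comp hf

theorem matIntegral_map {f : ℝ → A} (hf : IntegrableOn f (Ioi 0)) :
    matIntegral (fun u => ι (f u)) = ι (∫ u in Ioi 0, f u) := by
  have : CompleteSpace A := FiniteDimensional.complete ℂ A
  ext i j
  exact (LinearMap.toContinuousLinearMap
    ((Matrix.entryLinearMap ℂ ℂ i j).comp ι.toLinearMap)).integral_comp_comm hf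

theorem map_bgamma [Nontrivial A] {S : A} (hS : ∀ φ : characterSpace ℂ A, 0 < (φ S).re) :
    ι (bgamma S) = matGamma (ι S) := by
  have : CompleteSpace A := FiniteDimensional.complete ℂ A
  rw [bgamma, ← matIntegral_map ι (integrableOn_bgamma hS), matGamma]
  congr 1
  funext u
  rw [map_smul, map_bpow, map_sub, map_one]

/-- Passing to the larger matrix algebra loses no spectrum: an element invertible there is a
non-zero-divisor in `A`, hence a unit, because `A` is Artinian. -/
theorem character_mem_spectrum_map (hι : Function.Injective ι) (φ : characterSpace ℂ A) (S : A) :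
    φ S ∈ spectrum ℂ (ι S) := by
  intro h
  have hA : IsArtinianRing A := IsArtinianRing.of_finite ℂ A
  have h1 : IsUnit (algebraMap ℂ A (φ S) - S) := by
    refine IsArtinianRing.isUnit_of_mem_nonZeroDivisors (mem_nonZeroDivisors_iff_right.2 fun y hy => ?_)
    refine hι ?_
    rw [map_zero]
    refine h.mul_left_eq_zero.1 ?_
    rw [← AlgHom.commutes ι, ← map_sub, ← map_mul, hy, map_zero]
  exact AlgHom.apply_mem_spectrum φ S h1

end Transfer

/-- The biorthogonality relation for matrices in the image of a commutative algebra. -/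
theorem biorthogonality_of_algHom {A : Type*} [NormedCommRing A] [NormedAlgebra ℂ A]
    [FiniteDimensional ℂ A] [Nontrivial A] {p : ℕ} (ι : A →ₐ[ℂ] Matrix (Fin p) (Fin p) ℂ)
    (hι : Function.Injective ι) (h c : A) (υ : ℕ) (hυ : 1 ≤ υ) (n s : ℕ)
    (hC : ∀ z ∈ spectrum ℂ (ι c), -1 < z.re)
    (hH : ∀ x ∈ spectrum ℂ (ι h), 1 + (1 + (υ : ℝ)) * ((max n s : ℕ) : ℝ) < x.re) :
    (∀ k : ℕ, IsUnit (matPoch (1 + ι c) k)) ∧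
    IsUnit (matGamma (ι h + ι c - (s : ℂ) • 1)) ∧
    IsUnit (ι h - 1 - (((υ : ℂ) + 1) * (s : ℂ)) • 1) ∧
    MatIntegrable
      (fun u => matWeight (ι h) (ι c) u * polyM (ι h) (ι c) υ n u * polyCalM (ι h) (ι c) υ s u) ∧
    (s ≠ n → matIntegral
      (fun u => matWeight (ι h) (ι c) u * polyM (ι h) (ι c) υ n u *
        polyCalM (ι h) (ι c) υ s u) = 0) ∧
    (s = n → matIntegral
      (fun u => matWeight (ι h) (ι c) u * polyM (ι h) (ι c) υ n u * polyCalM (ι h) (ι c) υ s u) =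
        (s.factorial : ℂ) •
          ((matGamma (ι h + ι c - (s : ℂ) • 1))⁻¹ *
            matGamma (ι c + ((υ : ℂ) * (s : ℂ) + 1) • 1) *
            matGamma (ι h - (s : ℂ) • 1) *
            (ι h - 1 - (((υ : ℂ) + 1) * (s : ℂ)) • 1)⁻¹)) := by
  have : CompleteSpace A := FiniteDimensional.complete ℂ A
  have hc : ∀ φ : characterSpace ℂ A, -1 < (φ c).re :=
    fun φ => hC _ (character_mem_spectrum_map ι hι φ c)
  have hh : ∀ φ : characterSpace ℂ A, 1 + (1 + (υ : ℝ)) * ((max n s : ℕ) : ℝ) < (φ h).re :=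
    fun φ => hH _ (character_mem_spectrum_map ι hι φ h)
  have hc1 := re_character_one_add_pos hc
  have hh1 := fun j (hj : j ≤ max n s) => re_character_sub_pos hh (le_max_right n s) hj
  have hposa : ∀ φ : characterSpace ℂ A, 0 < (φ (h + c - s)).re := fun φ => by
    rw [show h + c - s = (c + 1) + (h - s - 1 - (υ * 0 : ℕ)) by simp; ring, map_add, Complex.add_re]
    exact add_pos (hc1 φ) (hh1 0 (Nat.zero_le _) φ)
  have hposc : ∀ φ : characterSpace ℂ A, 0 < (φ (c + (υ * s + 1))).re := fun φ => by
    rw [show c + ((υ : A) * s + 1) = (c + 1) + (υ * s : ℕ) by push_cast; ring, map_add,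
      map_natCast, Complex.add_re, Complex.natCast_re]
    have := hc1 φ
    positivity
  have hposh : ∀ φ : characterSpace ℂ A, 0 < (φ (h - s)).re := fun φ => by
    have := hh1 0 (Nat.zero_le _) φ
    rw [show h - s = (h - s - 1 - (υ * 0 : ℕ)) + 1 by simp, map_add, map_one, Complex.add_re,
      Complex.one_re]
    linarith
  have hunit : ∀ k, IsUnit ((ascPochhammer A k).eval (1 + c)) := fun k => by
    rw [add_comm]
    exact isUnit_ascPochhammer_eval hc1 k
  have hF : (fun u => matWeight (ι h) (ι c) u * polyM (ι h) (ι c) υ n u *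
      polyCalM (ι h) (ι c) υ s u) =
      fun u => ι (bweight h c u * bpolyM h c υ n u * bpolyCalM h c υ s u) := by
    funext u
    rw [map_mul, map_mul, map_bweight, map_bpolyM ι υ n hunit, map_bpolyCalM]
  have hint := integrableOn_pairing hυ hc hh
  have hga : matGamma (ι h + ι c - (s : ℂ) • 1) = ι (bgamma (h + c - s)) := by
    rw [map_bgamma ι hposa]
    congr 1
    simp [← Algebra.algebraMap_eq_smul_one]
  have hgc : matGamma (ι c + ((υ : ℂ) * (s : ℂ) + 1) • 1) = ι (bgamma (c + (υ * s + 1))) := by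
    rw [map_bgamma ι hposc]
    congr 1
    simp [← Algebra.algebraMap_eq_smul_one]
  have hgh : matGamma (ι h - (s : ℂ) • 1) = ι (bgamma (h - s)) := by
    rw [map_bgamma ι hposh]
    congr 1
    simp [← Algebra.algebraMap_eq_smul_one]
  have hd : ι h - 1 - (((υ : ℂ) + 1) * (s : ℂ)) • 1 = ι (h - 1 - (υ + 1) * (s : A)) := by
    simp [← Algebra.algebraMap_eq_smul_one]
  have hua := isUnit_bgamma_add_sub hc hh
  have hud := isUnit_sub_sub hh
  rw [hF, hga, hgc, hgh, hd, ← map_ringInverse ι hua, ← map_ringInverse ι hud,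
    matIntegral_map ι hint]
  refine ⟨fun k => ?_, hua.map ι, hud.map ι, matIntegrable_map ι hint, fun hsn => ?_,
    fun hsn => ?_⟩
  · have := (hunit k).map ι
    rwa [map_ascPochhammer_eval, map_add, map_one] at this
  · rw [integral_pairing_eq_zero hυ hc hh hsn, map_zero]
  · have h1 := integral_pairing_eq hυ hc hh hsn
    have h2 := Ring.inverse_mul_cancel _ hua
    have h3 := Ring.mul_inverse_cancel _ hud
    simp only [← map_mul, ← map_smul]
    congr 1
    rw [Nat.cast_smul_eq_nsmul, nsmul_eq_mul]
    set J := ∫ u in Ioi (0 : ℝ), bweight h c u * bpolyM h c υ n u * bpolyCalM h c υ s u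
    linear_combination (Ring.inverse (bgamma (h + c - s)) *
      Ring.inverse (h - 1 - (υ + 1) * (s : A))) * h1 - J * h2 - J *
        (Ring.inverse (bgamma (h + c - s)) * bgamma (h + c - s)) * h3

end

end

end CommBanach

/-! ### The algebra generated by `H` and `C`. -/

theorem theorem12 {p : ℕ} (H C : Matrix (Fin p) (Fin p) ℂ) (hHC : H * C = C * H)
    (υ : ℕ) (hυ : 1 ≤ υ) (n s : ℕ)
    (hC : ∀ z ∈ spectrum ℂ C, -1 < z.re)
    (hH : ∀ x ∈ spectrum ℂ H, 1 + (1 + (υ : ℝ)) * ((max n s : ℕ) : ℝ) < x.re) :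
    (∀ k : ℕ, IsUnit (matPoch (1 + C) k)) ∧
    IsUnit (matGamma (H + C - (s : ℂ) • 1)) ∧
    IsUnit (H - 1 - (((υ : ℂ) + 1) * (s : ℂ)) • 1) ∧
    MatIntegrable (fun u => matWeight H C u * polyM H C υ n u * polyCalM H C υ s u) ∧
    (s ≠ n →
      matIntegral (fun u => matWeight H C u * polyM H C υ n u * polyCalM H C υ s u) = 0) ∧
    (s = n →
      matIntegral (fun u => matWeight H C u * polyM H C υ n u * polyCalM H C υ s u) =
        (s.factorial : ℂ) •
          ((matGamma (H + C - (s : ℂ) • 1))⁻¹ *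
            matGamma (C + ((υ : ℂ) * (s : ℂ) + 1) • 1) *
            matGamma (H - (s : ℂ) • 1) *
            (H - 1 - (((υ : ℂ) + 1) * (s : ℂ)) • 1)⁻¹)) := by
  -- For `p = 0` the matrix ring is trivial and has no characters, but everything holds by
  -- uniqueness.
  rcases Nat.eq_zero_or_pos p with rfl | hp
  · exact ⟨fun _ => isUnit_of_subsingleton _, isUnit_of_subsingleton _, isUnit_of_subsingleton _,
      fun i => i.elim0, fun _ => Subsingleton.elim _ _, fun _ => Subsingleton.elim _ _⟩
  have : Nonempty (Fin p) := ⟨⟨0, hp⟩⟩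
  let S := Algebra.adjoin ℂ ({H, C} : Set (Matrix (Fin p) (Fin p) ℂ))
  have hS : ∀ a ∈ S, ∀ b ∈ S, a * b = b * a := by
    have hcomm : IsMulCommutative S := Algebra.isMulCommutative_adjoin ℂ (by
      rintro a (rfl | rfl) b (rfl | rfl) <;> first | rfl | exact hHC | exact hHC.symm)
    intro a ha b hb
    exact congrArg Subtype.val (hcomm.is_comm.comm (⟨a, ha⟩ : S) ⟨b, hb⟩)
  -- The norm serves only to make `S` a Banach algebra; the statement mentions none.
  let _ : NormedRing (Matrix (Fin p) (Fin p) ℂ) := Matrix.linftyOpNormedRing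
  let _ : NormedAlgebra ℂ (Matrix (Fin p) (Fin p) ℂ) := Matrix.linftyOpNormedAlgebra
  let _ : NormedCommRing S := CommBanach.subalgebraNormedCommRing S hS
  let _ : NormedAlgebra ℂ S := Subalgebra.toNormedAlgebra S
  exact CommBanach.biorthogonality_of_algHom S.val Subtype.val_injective
    ⟨H, Algebra.subset_adjoin (by simp)⟩ ⟨C, Algebra.subset_adjoin (by simp)⟩ υ hυ n s hC hH
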